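/- Let $n\ge 1$, let $p_1,\dots,p_n$ be Laurent polynomials in $Z_1,\dots,Z_n$ with complex coefficients, and consider on $(\mathbb C^*)^n$, where $\mathbb C^*=\mathbb C\setminus\{0\}$, the holomorphic vector field $$\dot z_i=z_i\,p_i(z),\qquad i=1,\dots,n. \tag{1}$$ A holomorphic vector field on $(\mathbb C^*)^k$ is called complete if through every point of $(\mathbb C^*)^k$ there is an integral curve $t\mapsto z(t)\in(\mathbb C^*)^k$ which is defined and holomorphic for all $t\in\mathbb C$. Let $\mathcal M$ be the multiplicative group generated by the monomials $Z^\alpha=Z_1^{\alpha_1}\cdots Z_n^{\alpha_n}$, $\alpha\in\mathbb Z^n$, which occur with non-zero coefficient in at least one $p_i$. Under $Z^\alpha\leftrightarrow\alpha$ it is isomorphic to a subgroup of $\mathbb Z^n$; let $m\le n$ be its rank. 1. If $m=n$, then (1) is not complete. 2. If $m<n$, let $W_i=\prod_{j=1}^n Z_j^{a_{ij}}$, $i=1,\dots,m$, be any basis of $\mathcal M$. Then there are Laurent polynomials $f_1,\dots,f_n$ in $m$ variables with $p_j(Z)=f_j(W_1,\dots,W_m)$ for all $j$, and for such $f_j$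 the field (1) is complete if and only if the vector field $$\dot w_i=w_i\sum_{j=1}^n a_{ij}f_j(w),\qquad i=1,\dots,m,$$ on $(\mathbb C^*)^m$ is complete. -/

import Mathlib

/-- Laurent polynomials over `ℂ` in `n` variables: the group algebra of the group `ℤⁿ` of exponents,
`Z ^ α` being the basis element at `α : Fin n → ℤ`. -/
abbrev LaurentPoly (n : ℕ) : Type := AddMonoidAlgebra ℂ (Fin n → ℤ)

/-- The monomial `z ^ α = ∏ i, z i ^ α i` at a point `z`, meant for points with all `z i ≠ 0`. -/
noncomputable def monomialAt {n : ℕ} (α : Fin n → ℤ) (z : Fin n → ℂ) : ℂ :=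
  ∏ i, z i ^ α i

/-- The value `∑ α, p_α z ^ α` of a Laurent polynomial at a point `z` of `(ℂ \ {0})ⁿ`. -/
noncomputable def LaurentPoly.evalAt {n : ℕ} (p : LaurentPoly n) (z : Fin n → ℂ) : ℂ :=
  ∑ α ∈ p.coeff.support, p.coeff α * monomialAt α z

/-- The substitution `f ↦ f(W)` of the monomials `W_i = Z ^ (a i)`, for `i : Fin m`, into a Laurent
polynomial in `m` variables: `W ^ β = Z ^ (∑ i, β i • a i)`. -/
noncomputable def LaurentPoly.substMonomials {m n : ℕ} (a : Fin m → Fin n → ℤ)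
    (f : LaurentPoly m) : LaurentPoly n :=
  ∑ β ∈ f.coeff.support, AddMonoidAlgebra.single (∑ i, β i • a i) (f.coeff β)

/-- The lattice in `ℤⁿ` generated by the exponents of all the monomials which occur in some `p i`
(in exponent notation, the multiplicative group generated by these monomials). -/
def monomialLattice {n : ℕ} (p : Fin n → LaurentPoly n) : Submodule ℤ (Fin n → ℤ) :=
  Submodule.span ℤ {α | ∃ i, (p i).coeff α ≠ 0}

/-- The vector field `X` on `(ℂ \ {0})ⁿ` is complete: through every point there is an integral curve,
with values in `(ℂ \ {0})ⁿ`, which is defined and holomorphic on all of `ℂ` (complex time). -/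
def IsCompleteOnTorus {n : ℕ} (X : (Fin n → ℂ) → Fin n → ℂ) : Prop :=
  ∀ c : Fin n → ℂ, (∀ i, c i ≠ 0) →
    ∃ z : ℂ → Fin n → ℂ, z 0 = c ∧ (∀ t i, z t i ≠ 0) ∧ ∀ t, HasDerivAt z (X (z t)) t

/-! Full rank: suppose the field is complete. An orbit lifts to z_j = exp u_j with u_j entire and
u_j' = p_j(z). Call an entire function controlled if its growth is polynomial in a bound for the |Re
u_j| on a larger disc. Controlled functions form an algebra that contains the u_j and is closed
under d/dt. Let D be the group of exponents α for which exp(α·u) is a quotient of controlled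
functions. A Borel-type theorem (`sum_eq_zero_of_add_eq_zero`) says that in a relation ∑ c_α
exp(α·u) = 0 with controlled c_α, the terms of each coset of D already sum to zero. Apply it to u_i'
= ∑ p_α exp(α·u), starting the orbit where no partial sum of any p_i vanishes: every occurring
exponent lies in D.

Since the lattice has finite index, exp(N u_j) is a quotient of controlled functions for some N ≥ 1.
Poisson's and Jensen's formulas then bound |Re u_j| by the logarithm of its own bound on a larger
disc (`exists_abs_re_le_of_mul_exp_eq`). Iteration gives logarithmic growth, so the u_j are
constant, all p_i vanish at the starting point, and hence no monomial occurs at all: the rank is 0,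
not n.

Lower rank: the monomials W map orbits to orbits of the reduced field and the torus onto the torus;
conversely z is recovered from w by integrating f_j(w) and exponentiating. -/

/-! ### Controlled growth. -/

/-- `G` is bounded on discs by a power of `R ^ 2 * M / (R - r)`, where `M` bounds the real parts of
the functions `u j` on a disc of radius `R > r`. -/
def HasControlledGrowth {ι : Type*} (u : ι → ℂ → ℂ) (G : ℂ → ℂ) : Prop :=
  ∃ (C : ℝ) (K : ℕ), 0 ≤ C ∧ ∀ r R M : ℝ, 1 ≤ r → r < R → 1 ≤ M →
    (∀ j t, ‖t‖ ≤ R → |(u j t).re| ≤ M) → ∀ t, ‖t‖ ≤ r → ‖G t‖ ≤ C * (R ^ 2 * M / (R - r)) ^ K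

theorem one_le_growth_base {r R M : ℝ} (hr : 1 ≤ r) (hR : r < R) (hM : 1 ≤ M) :
    1 ≤ R ^ 2 * M / (R - r) := by
  rw [one_le_div (by linarith)]
  nlinarith [mul_le_mul hM (show R ≤ R ^ 2 by nlinarith) (by linarith) (by linarith)]

namespace HasControlledGrowth

variable {ι : Type*} {u : ι → ℂ → ℂ} {F G : ℂ → ℂ}

theorem const (c : ℂ) : HasControlledGrowth u (fun _ => c) :=
  ⟨‖c‖, 0, norm_nonneg _, by simp⟩

theorem add (hF : HasControlledGrowth u F) (hG : HasControlledGrowth u G) :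
    HasControlledGrowth u (F + G) := by
  obtain ⟨C, K, hC, h⟩ := hF
  obtain ⟨C', K', hC', h'⟩ := hG
  refine ⟨C + C', K + K', by positivity, fun r R M hr hR hM hu t ht => ?_⟩
  have hX := one_le_growth_base hr hR hM
  have h1 := h r R M hr hR hM hu t ht
  have h2 := h' r R M hr hR hM hu t ht
  set X := R ^ 2 * M / (R - r)
  have h3 : X ^ K ≤ X ^ (K + K') := pow_le_pow_right₀ hX (by omega)
  have h4 : X ^ K' ≤ X ^ (K + K') := pow_le_pow_right₀ hX (by omega)
  calc ‖(F + G) t‖ ≤ ‖F t‖ + ‖G t‖ := norm_add_le _ _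
    _ ≤ C * X ^ K + C' * X ^ K' := by gcongr
    _ ≤ C * X ^ (K + K') + C' * X ^ (K + K') := by gcongr
    _ = _ := by ring

theorem mul (hF : HasControlledGrowth u F) (hG : HasControlledGrowth u G) :
    HasControlledGrowth u (F * G) := by
  obtain ⟨C, K, hC, h⟩ := hF
  obtain ⟨C', K', hC', h'⟩ := hG
  refine ⟨C * C', K + K', by positivity, fun r R M hr hR hM hu t ht => ?_⟩
  have hX := one_le_growth_base hr hR hM
  have h1 := h r R M hr hR hM hu t ht
  have h2 := h' r R M hr hR hM hu t ht
  set X := R ^ 2 * M / (R - r)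
  calc ‖(F * G) t‖ = ‖F t‖ * ‖G t‖ := norm_mul _ _
    _ ≤ C * X ^ K * (C' * X ^ K') := by gcongr
    _ = _ := by ring

/-- Cauchy's estimate on circles of radius (R - r) / 2: halving the gap doubles the base, and the
factor 1 / (R - r) costs one more power. -/
theorem deriv (hF : HasControlledGrowth u F) (hd : Differentiable ℂ F) :
    HasControlledGrowth u (_root_.deriv F) := by
  obtain ⟨C, K, hC, h⟩ := hF
  refine ⟨C * 2 ^ K * 2, K + 1, by positivity, fun r R M hr hR hM hu t ht => ?_⟩
  have hX := one_le_growth_base hr hR hM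
  have h1 := h ((r + R) / 2) R M (by linarith) (by linarith) hM hu
  have hXX : R ^ 2 * M / (R - (r + R) / 2) = 2 * (R ^ 2 * M / (R - r)) := by
    have : R - (r + R) / 2 = (R - r) / 2 := by ring
    rw [this]; field_simp
  rw [hXX] at h1
  have hinv : 1 / (R - r) ≤ R ^ 2 * M / (R - r) := by
    have : 1 ≤ R ^ 2 * M := one_le_mul_of_one_le_of_one_le (one_le_pow₀ (by linarith)) hM
    have : 0 < R - r := by linarith
    gcongr
  set X := R ^ 2 * M / (R - r)
  have hd' := Complex.norm_deriv_le_of_forall_mem_sphere_norm_le (c := t) (R := (R - r) / 2)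
    (C := C * (2 * X) ^ K) (by linarith) hd.diffContOnCl (fun z hz => by
      refine h1 z ?_
      have : ‖z - t‖ = (R - r) / 2 := by simpa [dist_eq_norm] using hz
      calc ‖z‖ = ‖(z - t) + t‖ := by simp
        _ ≤ ‖z - t‖ + ‖t‖ := norm_add_le _ _
        _ ≤ _ := by linarith)
  calc _ ≤ _ := hd'
    _ = C * (2 * X) ^ K * 2 * (1 / (R - r)) := by field_simp
    _ ≤ C * (2 * X) ^ K * 2 * X := by gcongr
    _ = _ := by ring

/-- The Borel–Carathéodory estimate. -/
theorem self (hd : ∀ j, Differentiable ℂ (u j)) (j : ι) : HasControlledGrowth u (u j) := by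
  refine ⟨2 + 2 * ‖u j 0‖, 1, by positivity, fun r R M hr hR hM hu t ht => ?_⟩
  have hRr : 0 < R - r := by linarith
  have hRt : R - r ≤ R - ‖t‖ := by linarith
  have h := Complex.borelCaratheodory (f := u j) (M := M) (R := R) (z := t) (by linarith)
    (hd j).differentiableOn
    (fun z hz => (le_abs_self _).trans (hu j z (by simpa using (Metric.mem_ball.1 hz).le)))
    (by linarith) (by simpa using lt_of_le_of_lt ht hR)
  calc _ ≤ _ := h
    _ ≤ 2 * M * R / (R - r) + ‖u j 0‖ * (R + R) / (R - r) := by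
        have : ‖t‖ ≤ R := by linarith
        have : 0 ≤ R := by linarith
        gcongr
    _ = (2 * (R * M) + 2 * ‖u j 0‖ * (R * 1)) / (R - r) := by ring
    _ ≤ (2 * (R ^ 2 * M) + 2 * ‖u j 0‖ * (R ^ 2 * M)) / (R - r) := by
        have : R ≤ R ^ 2 := by nlinarith
        gcongr
    _ = _ := by ring

end HasControlledGrowth

/-- The algebra of entire functions of controlled growth. -/
def controlledGrowth {ι : Type*} (u : ι → ℂ → ℂ) : Subalgebra ℂ (ℂ → ℂ) where
  carrier := {G | Differentiable ℂ G ∧ HasControlledGrowth u G}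
  mul_mem' hF hG := ⟨hF.1.mul hG.1, hF.2.mul hG.2⟩
  add_mem' hF hG := ⟨hF.1.add hG.1, hF.2.add hG.2⟩
  algebraMap_mem' c := ⟨differentiable_const c, .const c⟩

theorem deriv_mem_controlledGrowth {ι : Type*} {u : ι → ℂ → ℂ} {G : ℂ → ℂ}
    (hG : G ∈ controlledGrowth u) : deriv G ∈ controlledGrowth u :=
  ⟨fun t => ((hG.1.contDiff (n := 2)).differentiable_deriv_two t), hG.2.deriv hG.1⟩

/-! ### Jensen and Poisson estimates. -/

/-- A nonzero entire function has circle averages of `log ‖a‖` bounded below. -/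
theorem exists_le_circleAverage_log_norm {a : ℂ → ℂ} (ha : Differentiable ℂ a) :
    ∃ C : ℝ, ∀ R, 1 ≤ R → C ≤ Real.circleAverage (fun z => Real.log ‖a z‖) 0 R := by
  have hm : Meromorphic a := fun z => (ha.analyticAt z).meromorphicAt
  refine ⟨Real.log ‖meromorphicTrailingCoeffAt a 0‖, fun R hR => ?_⟩
  -- Jensen's formula; an entire function has no poles, and its zeros contribute nonnegatively once
  -- R ≥ 1.
  have h := ValueDistribution.logCounting_zero_sub_logCounting_top_eq_circleAverage_sub_const
    hm (R := R) (by linarith)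
  have h0 : 0 ≤ ValueDistribution.logCounting a 0 R := ValueDistribution.logCounting_nonneg hR
  have h1 : ValueDistribution.logCounting a ⊤ = 0 := by
    have han : AnalyticOnNhd ℂ a Set.univ := fun z _ => ha.analyticAt z
    rw [ValueDistribution.logCounting_top, negPart_eq_zero.2 ?_]
    · simp
    · exact MeromorphicOn.AnalyticOnNhd.divisor_nonneg han
  rw [Pi.sub_apply, h1] at h
  simp at h
  linarith

/-- If `a * exp h = b`, then `Re h` is bounded on a disc in terms of bounds for `a` and `b` on a
larger one. -/
theorem exists_re_le_of_mul_exp_eq {a b h : ℂ → ℂ} (ha : Differentiable ℂ a)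
    (hh : Differentiable ℂ h) (ha0 : a ≠ 0)
    (hab : ∀ t, a t * Complex.exp (h t) = b t) :
    ∃ C : ℝ, ∀ r R L : ℝ, 1 ≤ r → r < R → 0 ≤ L →
      (∀ t, ‖t‖ ≤ R → ‖b t‖ ≤ Real.exp L) → (∀ t, ‖t‖ ≤ R → ‖a t‖ ≤ Real.exp L) →
      ∀ t, ‖t‖ ≤ r → (h t).re ≤ (R + r) / (R - r) * (L + C) := by
  obtain ⟨C, hC⟩ := exists_le_circleAverage_log_norm ha
  refine ⟨-C, fun r R L hr hR hL hb hal t ht => ?_⟩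
  have hR0 : 0 < R := by linarith
  have htR : t ∈ Metric.ball (0 : ℂ) R := by simpa using lt_of_le_of_lt ht hR
  have hpois := InnerProductSpace.HarmonicOnNhd.circleAverage_poissonKernel_smul
    (f := fun z => (h z).re) (c := 0) (R := R)
    (fun z _ => (hh.analyticAt z).harmonicAt_re) htR
  have hκ : 0 ≤ (R + r) / (R - r) := div_nonneg (by linarith) (by linarith)
  have hker : ∀ z ∈ Metric.sphere (0 : ℂ) R,
      0 ≤ poissonKernel 0 t z ∧ poissonKernel 0 t z ≤ (R + r) / (R - r) := by
    intro z hz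
    rw [poissonKernel_eq_re_herglotzRieszKernel, Function.comp_apply, herglotzRieszKernel_def]
    have h1 := le_re_herglotzRieszKernel hz htR
    have h2 := re_herglotzRieszKernel_le hz htR
    have ht' : ‖t - 0‖ ≤ r := by simpa using ht
    have h0 := norm_nonneg (t - 0)
    refine ⟨(div_nonneg (by linarith) (by linarith)).trans h1, h2.trans ?_⟩
    have : 0 < R - r := by linarith
    have : 0 ≤ R + r := by linarith
    gcongr
  have hkc : ContinuousOn (poissonKernel 0 t) (Metric.sphere 0 R) := by
    rw [poissonKernel_eq_re_herglotzRieszKernel]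
    have := continuousOn_herglotzRieszKernel_sphere htR
    rw [abs_of_pos hR0] at this
    exact Complex.continuous_re.comp_continuousOn this
  set P : ℂ → ℝ := poissonKernel 0 t • fun z => (h z).re with hP
  have hPc : ContinuousOn P (Metric.sphere 0 R) :=
    hkc.mul (Complex.continuous_re.comp hh.continuous).continuousOn
  have hPi : CircleIntegrable P 0 R := hPc.circleIntegrable hR0.le
  obtain ⟨z0, hz0⟩ := Function.ne_iff.1 ha0
  have hcod : {z | a z ≠ 0} ∈ Filter.codiscrete ℂ := by
    have han : AnalyticOnNhd ℂ a Set.univ := fun z _ => ha.analyticAt z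
    have := han.preimage_zero_mem_codiscrete hz0
    simpa [Set.preimage, Set.compl_def] using this
  -- At zeros of `a` the convention log 0 = 0 would spoil the pointwise bound on `P`. Resetting `P`
  -- to 0 on this discrete set leaves the average unchanged.
  let F : ℂ → ℝ := fun z => if a z = 0 then 0 else P z
  have hFP : P =ᶠ[Filter.codiscreteWithin (Metric.sphere (0 : ℂ) |R|)] F := by
    have : ∀ᶠ z in Filter.codiscrete ℂ, a z ≠ 0 := hcod
    refine Filter.Eventually.filter_mono (Filter.codiscreteWithin_mono (Set.subset_univ _)) ?_
    filter_upwards [this] with z hz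
    simp [F, hz]
  have hFi := hPi.congr_codiscreteWithin hFP
  have hlog : CircleIntegrable (fun z => Real.log ‖a z‖) 0 R :=
    MeromorphicOn.circleIntegrable_log_norm fun z _ => (ha.analyticAt z).meromorphicAt
  have hLi : CircleIntegrable (fun z => L - Real.log ‖a z‖) 0 R :=
    (circleIntegrable_const L 0 R).sub hlog
  have hle : Real.circleAverage F 0 R
      ≤ Real.circleAverage (fun z => (R + r) / (R - r) * (L - Real.log ‖a z‖)) 0 R := by
    refine Real.circleAverage_mono hFi (hLi.const_fun_smul (a := (R + r) / (R - r))) ?_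
    intro z hz
    rw [abs_of_pos hR0] at hz
    have hzR : ‖z‖ ≤ R := by simpa using (mem_sphere_zero_iff_norm.1 hz).le
    obtain ⟨hk0, hk1⟩ := hker z hz
    by_cases haz : a z = 0
    · simpa [F, haz] using mul_nonneg hκ hL
    -- This makes L - log ‖a z‖ nonnegative, so the kernel may be replaced by its upper bound.
    · have hloga : Real.log ‖a z‖ ≤ L := by
        rw [Real.log_le_iff_le_exp (norm_pos_iff.2 haz)]; exact hal z hzR
      have hre : (h z).re ≤ L - Real.log ‖a z‖ := by
        have hb' := hb z hzR
        rw [← hab, norm_mul, Complex.norm_exp] at hb'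
        have := Real.log_le_log (mul_pos (norm_pos_iff.2 haz) (Real.exp_pos _)) hb'
        rw [Real.log_mul (norm_ne_zero_iff.2 haz) (Real.exp_ne_zero _), Real.log_exp,
          Real.log_exp] at this
        linarith
      have : P z = poissonKernel 0 t z * (h z).re := rfl
      simp only [F, haz, if_false, this]
      calc _ ≤ poissonKernel 0 t z * (L - Real.log ‖a z‖) := by gcongr
        _ ≤ _ := by gcongr
  rw [← Real.circleAverage_congr_codiscreteWithin hFP hR0.ne', hpois] at hle
  refine hle.trans ?_
  have hav : Real.circleAverage (fun z => (R + r) / (R - r) * (L - Real.log ‖a z‖)) 0 R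
      = (R + r) / (R - r) * (L - Real.circleAverage (fun z => Real.log ‖a z‖) 0 R) := by
    have := Real.circleAverage_fun_smul (a := (R + r) / (R - r))
      (f := fun z => L - Real.log ‖a z‖) (c := 0) (R := R)
    simp only [smul_eq_mul] at this
    rw [this, Real.circleAverage_fun_sub (circleIntegrable_const L 0 R) hlog,
      Real.circleAverage_const]
  rw [hav]
  have := hC R (by linarith)
  gcongr
  linarith


theorem norm_le_exp_of_le_mul_pow {x C D X : ℝ} {K K' : ℕ} (hC : 0 ≤ C) (hCD : C ≤ D)
    (hK : K ≤ K') (hX : 1 ≤ X) (hx : x ≤ C * X ^ K) :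
    x ≤ Real.exp (Real.log (1 + D) + K' * Real.log X) := by
  have hX0 : 0 < X := by linarith
  rw [Real.exp_add, Real.exp_log (by linarith), mul_comm (K' : ℝ), Real.exp_mul,
    Real.exp_log hX0, Real.rpow_natCast]
  refine hx.trans ?_
  have : X ^ K ≤ X ^ K' := pow_le_pow_right₀ hX hK
  have : C ≤ 1 + D := by linarith
  have : 0 ≤ 1 + D := by linarith
  gcongr

/-- If `exp (N * v)` is a quotient of functions of controlled growth, then `Re v` is bounded on discs
by the logarithm of a bound for the `Re (u j)` on larger discs. -/
theorem exists_abs_re_le_of_mul_exp_eq {ι : Type*} {u : ι → ℂ → ℂ} {v : ℂ → ℂ}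
    (hv : Differentiable ℂ v) {N : ℤ} (hN : N ≠ 0) {a b : ℂ → ℂ}
    (ha : a ∈ controlledGrowth u) (hb : b ∈ controlledGrowth u) (ha0 : a ≠ 0)
    (hab : ∀ t, a t * Complex.exp (N * v t) = b t) :
    ∃ C : ℝ, 0 ≤ C ∧ ∀ r R M : ℝ, 1 ≤ r → r < R → 1 ≤ M →
      (∀ j t, ‖t‖ ≤ R → |(u j t).re| ≤ M) → ∀ t, ‖t‖ ≤ r →
        |(v t).re| ≤ C * (R / (R - r)) * (1 + Real.log (R ^ 2 * M / (R - r))) := by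
  have hb0 : b ≠ 0 := by
    obtain ⟨t, ht⟩ := Function.ne_iff.1 ha0
    refine Function.ne_iff.2 ⟨t, ?_⟩
    rw [← hab]
    exact mul_ne_zero ht (Complex.exp_ne_zero _)
  -- Exchanging `a` and `b` replaces `v` by `-v`, which yields the bound from below.
  have hba : ∀ t, b t * Complex.exp (-(N * v t)) = a t := fun t => by
    rw [← hab, mul_assoc, ← Complex.exp_add]; simp
  obtain ⟨C₁, h₁⟩ := exists_re_le_of_mul_exp_eq ha.1 (hv.const_mul (N : ℂ)) ha0 hab
  obtain ⟨C₂, h₂⟩ := exists_re_le_of_mul_exp_eq hb.1 (hv.const_mul (N : ℂ)).neg hb0 hba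
  obtain ⟨Ca, Ka, hCa, hga⟩ := ha.2
  obtain ⟨Cb, Kb, hCb, hgb⟩ := hb.2
  set B : ℝ := Real.log (1 + (Ca + Cb)) with hB
  have hB0 : 0 ≤ B := Real.log_nonneg (by linarith)
  refine ⟨4 * (B + (Ka + Kb) + |C₁| + |C₂|), by positivity,
    fun r R M hr hR hM hu t ht => ?_⟩
  have hX := one_le_growth_base hr hR hM
  have hXX : R ^ 2 * M / (R - (r + R) / 2) = 2 * (R ^ 2 * M / (R - r)) := by
    have : R - (r + R) / 2 = (R - r) / 2 := by ring
    rw [this]; field_simp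
  -- The midpoint splits the gap: controlled growth is used from (r + R) / 2 to R, the Poisson bound
  -- from r to (r + R) / 2.
  have hga' := hga ((r + R) / 2) R M (by linarith) (by linarith) hM hu
  have hgb' := hgb ((r + R) / 2) R M (by linarith) (by linarith) hM hu
  rw [hXX] at hga' hgb'
  set X := R ^ 2 * M / (R - r)
  set L : ℝ := B + ((Ka + Kb : ℕ) : ℝ) * Real.log (2 * X) with hL
  have hlX : 0 ≤ Real.log X := Real.log_nonneg hX
  have hl2X : Real.log (2 * X) ≤ 1 + Real.log X := by
    rw [Real.log_mul (by norm_num) (by linarith)]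
    linarith [Real.log_two_lt_d9]
  have hL0 : 0 ≤ L := by
    have : 0 ≤ Real.log (2 * X) := Real.log_nonneg (by linarith)
    positivity
  have hbL : ∀ t, ‖t‖ ≤ (r + R) / 2 → ‖b t‖ ≤ Real.exp L := fun t ht =>
    norm_le_exp_of_le_mul_pow hCb (by linarith) (by omega) (by linarith) (hgb' t ht)
  have haL : ∀ t, ‖t‖ ≤ (r + R) / 2 → ‖a t‖ ≤ Real.exp L := fun t ht =>
    norm_le_exp_of_le_mul_pow hCa (by linarith) (by omega) (by linarith) (hga' t ht)
  have e₁ := h₁ r ((r + R) / 2) L hr (by linarith) hL0 hbL haL t ht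
  have e₂ := h₂ r ((r + R) / 2) L hr (by linarith) hL0 haL hbL t ht
  have hRr : 0 < R - r := by linarith
  have hκ : ((r + R) / 2 + r) / ((r + R) / 2 - r) ≤ 4 * (R / (R - r)) := by
    rw [show (r + R) / 2 - r = (R - r) / 2 by ring, div_le_iff₀ (by linarith)]
    field_simp
    linarith
  have hκ0 : 0 ≤ ((r + R) / 2 + r) / ((r + R) / 2 - r) :=
    div_nonneg (by linarith) (by linarith)
  have hS : L + |C₁| + |C₂| ≤ (B + (Ka + Kb) + |C₁| + |C₂|) * (1 + Real.log X) := by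
    have h1 : L ≤ B + (Ka + Kb) * (1 + Real.log X) := by
      rw [hL]; push_cast; gcongr
    nlinarith [mul_nonneg hB0 hlX, mul_nonneg (abs_nonneg C₁) hlX, mul_nonneg (abs_nonneg C₂) hlX]
  have key : ∀ x c : ℝ, c ≤ |C₁| + |C₂| →
      x ≤ ((r + R) / 2 + r) / ((r + R) / 2 - r) * (L + c) →
      x ≤ 4 * (B + (Ka + Kb) + |C₁| + |C₂|) * (R / (R - r)) * (1 + Real.log X) := by
    intro x c hc hx
    have hLS : 0 ≤ L + |C₁| + |C₂| := by positivity
    have hRR : 0 ≤ 4 * (R / (R - r)) := hκ0.trans hκ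
    calc x ≤ _ := hx
      _ ≤ ((r + R) / 2 + r) / ((r + R) / 2 - r) * (L + |C₁| + |C₂|) := by
          gcongr ?_ * ?_; linarith
      _ ≤ 4 * (R / (R - r)) * (L + |C₁| + |C₂|) := by gcongr
      _ ≤ 4 * (R / (R - r)) * ((B + (Ka + Kb) + |C₁| + |C₂|) * (1 + Real.log X)) := by gcongr
      _ = _ := by ring
  have habs : |(v t).re| ≤ |((N : ℂ) * v t).re| := by
    have : ((N : ℂ) * v t).re = N * (v t).re := by
      simp
    rw [this, abs_mul]
    have : (1 : ℝ) ≤ |(N : ℝ)| := by exact_mod_cast Int.one_le_abs hN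
    exact le_mul_of_one_le_left (abs_nonneg _) this
  refine habs.trans (abs_le'.2 ⟨key _ C₁ ?_ e₁, key _ C₂ ?_ e₂⟩)
  · linarith [le_abs_self C₁, abs_nonneg C₂]
  · linarith [le_abs_self C₂, abs_nonneg C₁]

/-! ### From self-improvement to constancy. -/

/-- A self-improving bound on discs forces logarithmic growth. -/
theorem le_log_of_self_improving {P : ℝ → ℝ → Prop}
    (hmono : ∀ {r M M'}, M ≤ M' → P r M → P r M')
    (hanti : ∀ {r R M}, r ≤ R → P R M → P r M)
    (hlim : ∀ {r M}, (∀ ε > 0, P r (M + ε)) → P r M)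
    (hex : ∀ r, ∃ M, P r M) {C : ℝ} (hC : 1 ≤ C)
    (himp : ∀ r R M : ℝ, 1 ≤ r → r < R → 1 ≤ M → P R M →
      P r (C * (R / (R - r)) * (1 + Real.log (R ^ 2 * M / (R - r))))) :
    ∀ r, 1 ≤ r → P r (32 * C * (8 + Real.log C + Real.log r)) := by
  intro r hr
  have hr0 : 0 < r := by linarith
  have hlC : 0 ≤ Real.log C := Real.log_nonneg hC
  have hlr : 0 ≤ Real.log r := Real.log_nonneg hr
  set A := 8 + Real.log C + Real.log r with hA
  set D := 32 * C * A with hD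
  have hD0 : 0 < D := by positivity
  have hD1 : 1 ≤ D := by
    have : 8 ≤ A := by linarith
    nlinarith
  -- Radii increasing from r towards 2r, with gaps r / 2 ^ (k + 1).
  set ρ : ℕ → ℝ := fun k => r * (2 - (1 / 2) ^ k) with hρ
  have hstep : ∀ (k : ℕ) (M : ℝ), 1 ≤ M → P (ρ (k + 1)) M → P (ρ k) (D * 3 ^ k / 4 + M / 4) := by
    intro k M hM hP
    have hpk : (0 : ℝ) < (1 / 2) ^ k := by positivity
    have hpk1 : ((1 : ℝ) / 2) ^ k ≤ 1 := pow_le_one₀ (by norm_num) (by norm_num)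
    have hρk : 1 ≤ ρ k := by simp only [hρ]; nlinarith
    have hdiff : ρ (k + 1) - ρ k = r * (1 / 2) ^ (k + 1) := by simp only [hρ]; ring
    have hlt : ρ k < ρ (k + 1) := by
      have : 0 < ρ (k + 1) - ρ k := by rw [hdiff]; positivity
      linarith
    have hρ2 : ρ (k + 1) ≤ 2 * r := by
      simp only [hρ]; nlinarith [show (0 : ℝ) < (1 / 2) ^ (k + 1) by positivity]
    have h := himp (ρ k) (ρ (k + 1)) M hρk hlt hM hP
    refine hmono ?_ h
    have hX := one_le_growth_base hρk hlt hM
    have hq : ρ (k + 1) / (ρ (k + 1) - ρ k) ≤ 4 * 2 ^ k := by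
      rw [hdiff, div_le_iff₀ (by positivity)]
      have : 4 * 2 ^ k * (r * (1 / 2) ^ (k + 1)) = 2 * r * ((2 : ℝ) ^ k * (1 / 2) ^ k) := by ring
      rw [this, ← mul_pow]
      simpa using hρ2
    have hX2 : ρ (k + 1) ^ 2 * M / (ρ (k + 1) - ρ k) ≤ 8 * r * 2 ^ k * M := by
      have h0 : 0 ≤ ρ (k + 1) := by linarith
      calc _ = ρ (k + 1) / (ρ (k + 1) - ρ k) * ρ (k + 1) * M := by ring
        _ ≤ 4 * 2 ^ k * (2 * r) * M := by gcongr
        _ = _ := by ring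
    have hq0 : 0 ≤ ρ (k + 1) / (ρ (k + 1) - ρ k) :=
      div_nonneg (by linarith) (by linarith)
    have hlogX := Real.log_le_log (by linarith) hX2
    have hlog2 : Real.log 2 ≤ 1 := by linarith [Real.log_two_lt_d9]
    -- log x ≤ x - 1 at x = M / (16 C 2^k): the prefactor 4 C 2^k then turns the linear term into
    -- exactly M / 4.
    have hlM : Real.log M ≤ M / (16 * C * 2 ^ k) + (4 + Real.log C + k) := by
      have e : M = M / (16 * C * 2 ^ k) * (16 * C * 2 ^ k) := by field_simp
      have hpos : 0 < M / (16 * C * 2 ^ k) := by positivity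
      conv_lhs => rw [e]
      rw [Real.log_mul hpos.ne' (by positivity), Real.log_mul (by positivity) (by positivity),
        Real.log_mul (by norm_num) (by positivity), Real.log_pow,
        show (16 : ℝ) = 2 ^ 4 by norm_num, Real.log_pow]
      have h1 := Real.log_le_sub_one_of_pos hpos
      rw [show (16 : ℝ) = 2 ^ 4 by norm_num] at h1
      have : (k : ℝ) * Real.log 2 ≤ k * 1 := by gcongr
      push_cast
      linarith
    have hlog : Real.log (8 * r * 2 ^ k * M) ≤ 3 + Real.log r + k + Real.log M := by
      rw [Real.log_mul (by positivity) (by positivity),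
        Real.log_mul (by positivity) (by positivity), Real.log_mul (by norm_num) (by positivity),
        Real.log_pow, show (8 : ℝ) = 2 ^ 3 by norm_num, Real.log_pow]
      have : (k : ℝ) * Real.log 2 ≤ k * 1 := by gcongr
      push_cast
      linarith
    have hlX0 := Real.log_nonneg hX
    -- Bernoulli for (3/2)^k absorbs the term linear in k.
    have hb : (1 + (k : ℝ) / 2) * 2 ^ k ≤ 3 ^ k := by
      have := one_add_mul_le_pow (a := (1 / 2 : ℝ)) (by norm_num) k
      calc (1 + (k : ℝ) / 2) * 2 ^ k ≤ (1 + 1 / 2) ^ k * 2 ^ k := by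
            gcongr; linarith
        _ = 3 ^ k := by rw [← mul_pow]; norm_num
    calc _ ≤ C * (4 * 2 ^ k) * (1 + (3 + Real.log r + k + (M / (16 * C * 2 ^ k)
            + (4 + Real.log C + k)))) := by gcongr; linarith
      _ = C * 4 * 2 ^ k * (A + 2 * k) + M / 4 := by rw [hA]; field_simp; ring
      _ ≤ C * 4 * 2 ^ k * (A * (2 * (1 + k / 2))) + M / 4 := by
          gcongr
          have : (0 : ℝ) ≤ k := by positivity
          nlinarith
      _ = 8 * C * A * ((1 + k / 2) * 2 ^ k) + M / 4 := by ring
      _ ≤ 8 * C * A * 3 ^ k + M / 4 := by gcongr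
      _ = _ := by rw [hD]; ring
  -- The profile D 3^k is a fixed point of the step, since 3^k / 4 + 3^(k+1) / 4 = 3^k, while the
  -- excess E shrinks by a factor 4.
  have hiter : ∀ (k : ℕ) (E : ℝ), 0 ≤ E → P (ρ k) (D * 3 ^ k + E) → P (ρ 0) (D + E / 4 ^ k) := by
    intro k
    induction k with
    | zero => intro E _ h; simpa using h
    | succ k ih =>
      intro E hE h
      have h3 : (1 : ℝ) ≤ 3 ^ (k + 1) := one_le_pow₀ (by norm_num)
      have h1 := hstep k _ (by nlinarith) h
      have h2 := ih (E / 4) (by positivity) (hmono (by rw [pow_succ]; linarith) h1)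
      rw [pow_succ]
      refine hmono (le_of_eq ?_) h2
      ring
  obtain ⟨E, hE⟩ := hex (2 * r)
  have hρ0 : ρ 0 = r := by simp only [hρ]; norm_num
  have hfin : ∀ k : ℕ, P r (D + |E| / 4 ^ k) := by
    intro k
    rw [← hρ0]
    refine hiter k |E| (abs_nonneg _) (hmono ?_ (hanti ?_ hE))
    · have : 0 < D * 3 ^ k := by positivity
      linarith [le_abs_self E]
    · simp only [hρ]
      nlinarith [show (0 : ℝ) < (1 / 2) ^ k by positivity]
  refine hlim fun ε hε => ?_
  obtain ⟨k, hk⟩ := pow_unbounded_of_one_lt (|E| / ε) (show (1 : ℝ) < 4 by norm_num)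
  refine hmono ?_ (hfin k)
  have : |E| / 4 ^ k ≤ ε := by
    rw [div_lt_iff₀ hε] at hk
    rw [div_le_iff₀ (by positivity)]
    linarith
  linarith

/-- An entire function whose real part grows at most logarithmically is constant. -/
theorem deriv_eq_zero_of_re_le_log {f : ℂ → ℂ} (hf : Differentiable ℂ f) {A B : ℝ}
    (h : ∀ r, 1 ≤ r → ∀ t, ‖t‖ ≤ r → |(f t).re| ≤ A + B * Real.log r) (c : ℂ) :
    deriv f c = 0 := by
  -- The circle of radius r about c lies in the disc of radius 2r; Borel–Carathéodory is applied on
  -- the disc of radius 4r.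
  set M : ℝ → ℝ := fun r => 1 + |A| + |B| * Real.log (4 * r) with hM
  have hbound : ∀ r, 1 ≤ r → ‖c‖ ≤ r → ‖deriv f c‖ ≤ (2 * M r + 3 * ‖f 0‖) * 2 / r := by
    intro r hr hc
    have hlog : 0 ≤ Real.log (4 * r) := Real.log_nonneg (by linarith)
    have hM0 : 0 < M r := by positivity
    have hre : ∀ t, ‖t‖ ≤ 4 * r → (f t).re ≤ M r := fun t ht => by
      have h1 := (le_abs_self _).trans (h (4 * r) (by linarith) t ht)
      have h2 : B * Real.log (4 * r) ≤ |B| * Real.log (4 * r) := by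
        gcongr; exact le_abs_self B
      simp only [hM]
      linarith [le_abs_self A]
    have hd := Complex.norm_deriv_le_of_forall_mem_sphere_norm_le (c := c) (R := r)
      (C := 2 * M r + 3 * ‖f 0‖) (by linarith) hf.diffContOnCl ?_
    · refine hd.trans ?_
      gcongr
      have := norm_nonneg (f 0)
      linarith
    · intro z hz
      have hz' : ‖z‖ ≤ 2 * r := by
        have : ‖z - c‖ = r := by simpa [dist_eq_norm] using hz
        calc ‖z‖ = ‖(z - c) + c‖ := by simp
          _ ≤ ‖z - c‖ + ‖c‖ := norm_add_le _ _
          _ ≤ _ := by linarith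
      have hbc := Complex.borelCaratheodory (f := f) (M := M r) (R := 4 * r) (z := z) hM0
        hf.differentiableOn
        (fun w hw => hre w (by simpa using (Metric.mem_ball.1 hw).le)) (by linarith)
        (by rw [mem_ball_zero_iff]; linarith)
      have hden : 0 < 4 * r - ‖z‖ := by linarith
      have h1 : ‖z‖ / (4 * r - ‖z‖) ≤ 1 := by rw [div_le_one hden]; linarith
      have h2 : (4 * r + ‖z‖) / (4 * r - ‖z‖) ≤ 3 := by rw [div_le_iff₀ hden]; linarith
      calc _ ≤ _ := hbc
        _ = 2 * M r * (‖z‖ / (4 * r - ‖z‖)) + ‖f 0‖ * ((4 * r + ‖z‖) / (4 * r - ‖z‖)) := by ring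
        _ ≤ 2 * M r * 1 + ‖f 0‖ * 3 := by gcongr
        _ = _ := by ring
  have hlim : Filter.Tendsto (fun r : ℝ => (2 * M r + 3 * ‖f 0‖) * 2 / r) Filter.atTop
      (nhds 0) := by
    have h1 : Filter.Tendsto (fun r : ℝ => Real.log r / r) Filter.atTop (nhds 0) :=
      Real.isLittleO_log_id_atTop.tendsto_div_nhds_zero
    have h2 : Filter.Tendsto (fun r : ℝ => r⁻¹) Filter.atTop (nhds 0) := tendsto_inv_atTop_zero
    have h3 := (h1.const_mul (4 * |B|)).add
      (h2.const_mul (4 * (1 + |A| + |B| * Real.log 4) + 6 * ‖f 0‖))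
    simp only [mul_zero, add_zero] at h3
    refine h3.congr' ?_
    filter_upwards [Filter.eventually_gt_atTop 0] with r hr
    simp only [hM]
    rw [Real.log_mul (by norm_num) hr.ne']
    field_simp
    ring
  have : ‖deriv f c‖ ≤ 0 := by
    refine ge_of_tendsto hlim ?_
    filter_upwards [Filter.eventually_ge_atTop 1, Filter.eventually_ge_atTop ‖c‖] with r h1 h2
    exact hbound r h1 h2
  simpa using this

/-- If each `u j` has a nonzero multiple whose exponential is a quotient of functions of controlled
growth, then all `u j` are constant. -/
theorem deriv_eq_zero_of_mul_exp_eq {ι : Type*} [Finite ι] {u : ι → ℂ → ℂ}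
    (hu : ∀ j, Differentiable ℂ (u j))
    (h : ∀ j, ∃ N : ℤ, N ≠ 0 ∧ ∃ a ∈ controlledGrowth u, ∃ b ∈ controlledGrowth u,
      a ≠ 0 ∧ ∀ t, a t * Complex.exp (N * u j t) = b t) (j : ι) (t : ℂ) :
    deriv (u j) t = 0 := by
  have h' : ∀ j, ∃ C : ℝ, 0 ≤ C ∧ ∀ r R M : ℝ, 1 ≤ r → r < R → 1 ≤ M →
      (∀ j t, ‖t‖ ≤ R → |(u j t).re| ≤ M) → ∀ t, ‖t‖ ≤ r →
        |(u j t).re| ≤ C * (R / (R - r)) * (1 + Real.log (R ^ 2 * M / (R - r))) := fun j => by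
    obtain ⟨N, hN, a, ha, b, hb, ha0, hab⟩ := h j
    exact exists_abs_re_le_of_mul_exp_eq (hu j) hN ha hb ha0 hab
  choose C hC0 hC using h'
  obtain ⟨C', hC'⟩ := (Set.finite_range C).bddAbove
  have hlog := le_log_of_self_improving (P := fun r M => ∀ j t, ‖t‖ ≤ r → |(u j t).re| ≤ M)
    (fun hM hP j t ht => (hP j t ht).trans hM)
    (fun hr hP j t ht => hP j t (ht.trans hr))
    (fun hP j t ht => le_of_forall_pos_le_add fun ε hε => hP ε hε j t ht)
    (fun r => by
      have hb : ∀ j, ∃ M, ∀ t, ‖t‖ ≤ r → |(u j t).re| ≤ M := fun j => by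
        obtain ⟨M, hM⟩ := (isCompact_closedBall (0 : ℂ) r).exists_bound_of_continuousOn
          (f := fun t => (u j t).re) (Complex.continuous_re.comp (hu j).continuous).continuousOn
        exact ⟨M, fun t ht => hM t (by simpa using ht)⟩
      choose M hM using hb
      obtain ⟨M', hM'⟩ := (Set.finite_range M).bddAbove
      exact ⟨M', fun j t ht => (hM j t ht).trans (hM' ⟨j, rfl⟩)⟩)
    (C := max 1 C') (le_max_left _ _)
    (fun r R M hr hR hM hP j t ht => by
      refine (hC j r R M hr hR hM hP t ht).trans ?_
      have h1 : 0 ≤ R / (R - r) := div_nonneg (by linarith) (by linarith)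
      have h2 := Real.log_nonneg (one_le_growth_base hr hR hM)
      have h3 : C j ≤ max 1 C' := (hC' ⟨j, rfl⟩).trans (le_max_right _ _)
      gcongr)
  refine deriv_eq_zero_of_re_le_log (hu j)
    (A := 32 * max 1 C' * (8 + Real.log (max 1 C'))) (B := 32 * max 1 C')
    (fun r hr t ht => (hlog r hr j t ht).trans (le_of_eq ?_)) t
  ring


/-! ### A Borel theorem for exponentials with controlled coefficients. -/

/-- The exponential `exp (∑ j, α j * u j)`. -/
noncomputable def expComb {n : ℕ} (u : Fin n → ℂ → ℂ) (α : Fin n → ℤ) (t : ℂ) : ℂ :=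
  Complex.exp (∑ j, (α j : ℂ) * u j t)

section expComb

variable {n : ℕ} {u : Fin n → ℂ → ℂ}

theorem expComb_zero (t : ℂ) : expComb u 0 t = 1 := by simp [expComb]

theorem expComb_add (α β : Fin n → ℤ) (t : ℂ) :
    expComb u (α + β) t = expComb u α t * expComb u β t := by
  simp [expComb, ← Complex.exp_add, add_mul, Finset.sum_add_distrib]

theorem expComb_ne_zero (α : Fin n → ℤ) (t : ℂ) : expComb u α t ≠ 0 := Complex.exp_ne_zero _

theorem hasDerivAt_expComb (hu : ∀ j, Differentiable ℂ (u j)) (α : Fin n → ℤ) (t : ℂ) :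
    HasDerivAt (expComb u α) (expComb u α t * ∑ j, (α j : ℂ) * deriv (u j) t) t :=
  (HasDerivAt.fun_sum fun j _ => ((hu j t).hasDerivAt.const_mul (α j : ℂ))).cexp

end expComb

theorem Differentiable.mul_ne_zero {a b : ℂ → ℂ} (ha : Differentiable ℂ a)
    (hb : Differentiable ℂ b) (ha0 : a ≠ 0) (hb0 : b ≠ 0) : a * b ≠ 0 := by
  intro h
  rcases AnalyticOnNhd.eq_zero_or_eq_zero_of_mul_eq_zero (U := Set.univ)
    (fun z _ => ha.analyticAt z) (fun z _ => hb.analyticAt z) (fun z _ => congrFun h z)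
    isPreconnected_univ with h | h
  · exact ha0 (funext fun z => h z trivial)
  · exact hb0 (funext fun z => h z trivial)

/-- F / G has derivative zero near a point where G ≠ 0; the identity theorem spreads the
proportionality. -/
theorem exists_eq_const_mul_of_wronskian_eq_zero {F G : ℂ → ℂ} (hF : Differentiable ℂ F)
    (hG : Differentiable ℂ G) (hG0 : G ≠ 0) (hW : ∀ t, G t * deriv F t = F t * deriv G t) :
    ∃ k : ℂ, ∀ t, F t = k * G t := by
  obtain ⟨z, hz⟩ := Function.ne_iff.1 hG0
  obtain ⟨ε, hε, hball⟩ := Metric.mem_nhds_iff.1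
    (hG.continuous.continuousAt.eventually_ne (x := z) (y := 0) hz)
  have hq : ∀ t ∈ Metric.ball z ε, HasDerivAt (fun t => F t / G t) 0 t := fun t ht => by
    have := (hF t).hasDerivAt.div (hG t).hasDerivAt (hball ht)
    rwa [show deriv F t * G t - F t * deriv G t = 0 by rw [← hW]; ring, zero_div] at this
  have hconst : ∀ t ∈ Metric.ball z ε, F t / G t = F z / G z := fun t ht =>
    Metric.isOpen_ball.is_const_of_deriv_eq_zero (convex_ball z ε).isPreconnected
      (fun t ht => (hq t ht).differentiableAt.differentiableWithinAt)
      (fun t ht => (hq t ht).deriv) ht (Metric.mem_ball_self hε)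
  refine ⟨F z / G z, fun t => ?_⟩
  have h := AnalyticOnNhd.eq_of_eventuallyEq (f := F) (g := fun t => F z / G z * G t) (z₀ := z)
    (fun z _ => hF.analyticAt z) (fun w _ => (hG.const_mul _).analyticAt w)
    (by
      filter_upwards [Metric.ball_mem_nhds z hε] with t ht
      rw [← hconst t ht, div_mul_cancel₀ _ (hball ht)])
  exact congrFun h t

/-- The exponents `α` for which `exp (∑ j, α j * u j)` is a quotient of functions of controlled
growth. -/
def controlledExponents {n : ℕ} (u : Fin n → ℂ → ℂ) : AddSubgroup (Fin n → ℤ) where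
  carrier := {α | ∃ a ∈ controlledGrowth u, ∃ b ∈ controlledGrowth u,
    a ≠ 0 ∧ ∀ t, a t * expComb u α t = b t}
  zero_mem' := ⟨1, one_mem _, 1, one_mem _, one_ne_zero, fun t => by simp [expComb_zero]⟩
  add_mem' := by
    rintro α β ⟨a, ha, b, hb, ha0, h⟩ ⟨a', ha', b', hb', ha0', h'⟩
    refine ⟨a * a', mul_mem ha ha', b * b', mul_mem hb hb', ha.1.mul_ne_zero ha'.1 ha0 ha0',
      fun t => ?_⟩
    simp only [Pi.mul_apply, expComb_add, ← h, ← h']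
    ring
  neg_mem' := by
    rintro α ⟨a, ha, b, hb, ha0, h⟩
    refine ⟨b, hb, a, ha, ?_, fun t => ?_⟩
    · obtain ⟨t, ht⟩ := Function.ne_iff.1 ha0
      exact Function.ne_iff.2 ⟨t, by rw [← h]; exact mul_ne_zero ht (expComb_ne_zero _ _)⟩
    · rw [← h, mul_assoc, ← expComb_add, add_neg_cancel, expComb_zero, mul_one]

section Borel

variable {n : ℕ} {u : Fin n → ℂ → ℂ}

/-- Within a coset of `controlledExponents u`, all exponentials are controlled quotients times the
one at β; clear denominators. -/
theorem exists_mul_sum_eq_mul_expComb {A : Finset (Fin n → ℤ)} {β : Fin n → ℤ}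
    (hA : ∀ α ∈ A, α - β ∈ controlledExponents u) {c : (Fin n → ℤ) → ℂ → ℂ}
    (hc : ∀ α, c α ∈ controlledGrowth u) :
    ∃ a ∈ controlledGrowth u, ∃ b ∈ controlledGrowth u, a ≠ 0 ∧
      ∀ t, a t * ∑ α ∈ A, c α t * expComb u α t = b t * expComb u β t := by
  induction A using Finset.induction_on with
  | empty => exact ⟨1, one_mem _, 0, zero_mem _, one_ne_zero, fun t => by simp⟩
  | insert α A hα ih =>
    obtain ⟨a, ha, b, hb, ha0, h⟩ := ih fun γ hγ => hA γ (Finset.mem_insert_of_mem hγ)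
    obtain ⟨a', ha', b', hb', ha0', h'⟩ := hA α (Finset.mem_insert_self _ _)
    refine ⟨a * a', mul_mem ha ha', c α * a * b' + a' * b,
      add_mem (mul_mem (mul_mem (hc α) ha) hb') (mul_mem ha' hb),
      ha.1.mul_ne_zero ha'.1 ha0 ha0', fun t => ?_⟩
    have e : expComb u α t = expComb u (α - β) t * expComb u β t := by
      rw [← expComb_add, sub_add_cancel]
    rw [Finset.sum_insert hα]
    simp only [Pi.mul_apply, Pi.add_apply, ← h', e]
    linear_combination a' t * h t

/-- Induction on the terms outside the coset. The Wronskian with one such term c_l exp(l·u)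
eliminates it and keeps the coefficients controlled. By induction the Wronskian of the coset sum
vanishes, so this sum is k c_l exp(l·u). If k ≠ 0, clearing denominators puts l in the coset, a
contradiction. -/
theorem sum_eq_zero_of_add_eq_zero (hu : ∀ j, Differentiable ℂ (u j))
    {A : Finset (Fin n → ℤ)} {β : Fin n → ℤ} (hA : ∀ α ∈ A, α - β ∈ controlledExponents u)
    {B : Finset (Fin n → ℤ)} (hB : ∀ α ∈ B, α - β ∉ controlledExponents u)
    {c : (Fin n → ℤ) → ℂ → ℂ} (hc : ∀ α, c α ∈ controlledGrowth u)
    (h : ∀ t, ∑ α ∈ A, c α t * expComb u α t + ∑ α ∈ B, c α t * expComb u α t = 0) (t : ℂ) :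
    ∑ α ∈ A, c α t * expComb u α t = 0 := by
  induction B using Finset.induction_on generalizing c t with
  | empty => simpa using h t
  | insert l B hl ih =>
    have ih' := @ih (fun α hα => hB α (Finset.mem_insert_of_mem hα))
    by_cases hcl : c l = 0
    · exact ih' hc (fun t => by simpa [Finset.sum_insert hl, hcl] using h t) t
    -- The logarithmic derivative of `expComb u α`.
    let lam : (Fin n → ℤ) → ℂ → ℂ := fun α t => ∑ j, (α j : ℂ) * deriv (u j) t
    have hlam : ∀ α, lam α ∈ controlledGrowth u := fun α => by
      have : lam α = ∑ j, (α j : ℂ) • deriv (u j) := by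
        ext t; simp [lam]
      rw [this]
      exact sum_mem fun j _ => Subalgebra.smul_mem _
        (deriv_mem_controlledGrowth ⟨hu j, .self hu j⟩) _
    have hterm : ∀ α t, HasDerivAt (fun t => c α t * expComb u α t)
        ((deriv (c α) t + c α t * lam α t) * expComb u α t) t := fun α t => by
      refine (((hc α).1 t).hasDerivAt.mul (hasDerivAt_expComb hu α t)).congr_deriv ?_
      simp only [lam]; ring
    have hsum : ∀ (s : Finset (Fin n → ℤ)) t,
        HasDerivAt (fun t => ∑ α ∈ s, c α t * expComb u α t)
          (∑ α ∈ s, (deriv (c α) t + c α t * lam α t) * expComb u α t) t := fun s t =>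
      HasDerivAt.fun_sum fun α _ => hterm α t
    let c' : (Fin n → ℤ) → ℂ → ℂ := fun α =>
      c l * (deriv (c α) + c α * lam α) - c α * (deriv (c l) + c l * lam l)
    have hc' : ∀ α, c' α ∈ controlledGrowth u := fun α =>
      sub_mem (mul_mem (hc l) (add_mem (deriv_mem_controlledGrowth (hc α))
        (mul_mem (hc α) (hlam α)))) (mul_mem (hc α) (add_mem (deriv_mem_controlledGrowth (hc l))
        (mul_mem (hc l) (hlam l))))
    have hwr : ∀ (s : Finset (Fin n → ℤ)) t, ∑ α ∈ s, c' α t * expComb u α t =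
        c l t * ∑ α ∈ s, (deriv (c α) t + c α t * lam α t) * expComb u α t
        - (deriv (c l) t + c l t * lam l t) * ∑ α ∈ s, c α t * expComb u α t := fun s t => by
      rw [Finset.mul_sum, Finset.mul_sum, ← Finset.sum_sub_distrib]
      refine Finset.sum_congr rfl fun α _ => ?_
      simp only [c', Pi.sub_apply, Pi.mul_apply, Pi.add_apply]
      ring
    have hder : ∀ t, ∑ α ∈ A, (deriv (c α) t + c α t * lam α t) * expComb u α t +
        ∑ α ∈ insert l B, (deriv (c α) t + c α t * lam α t) * expComb u α t = 0 := fun t => by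
      refine ((hsum A t).add (hsum (insert l B) t)).unique ?_
      have : (fun t => ∑ α ∈ A, c α t * expComb u α t) +
          (fun t => ∑ α ∈ insert l B, c α t * expComb u α t) = fun _ => 0 := funext h
      rw [this]
      exact hasDerivAt_const t 0
    have h0 := ih' hc' fun t => by
      have h1 := h t
      have h2 := hder t
      rw [Finset.sum_insert hl] at h1 h2
      rw [hwr, hwr]
      linear_combination c l t * h2 - (deriv (c l) t + c l t * lam l t) * h1
    have hG : Differentiable ℂ fun t => c l t * expComb u l t := fun t =>
      (hterm l t).differentiableAt
    have hG0 : (fun t => c l t * expComb u l t) ≠ 0 := by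
      obtain ⟨z, hz⟩ := Function.ne_iff.1 hcl
      exact Function.ne_iff.2 ⟨z, mul_ne_zero hz (expComb_ne_zero _ _)⟩
    obtain ⟨k, hk⟩ := exists_eq_const_mul_of_wronskian_eq_zero
      (fun t => (hsum A t).differentiableAt) hG hG0 fun t => by
        rw [(hsum A t).deriv, (hterm l t).deriv]
        have := h0 t
        rw [hwr] at this
        linear_combination expComb u l t * this
    by_cases hk0 : k = 0
    · rw [hk, hk0, zero_mul]
    refine absurd ?_ (hB l (Finset.mem_insert_self _ _))
    obtain ⟨a, ha, b, hb, ha0, hab⟩ := exists_mul_sum_eq_mul_expComb hA hc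
    refine ⟨k • (a * c l), Subalgebra.smul_mem _ (mul_mem ha (hc l)) k, b, hb,
      smul_ne_zero hk0 (ha.1.mul_ne_zero (hc l).1 ha0 hcl), fun t => ?_⟩
    have h1 := hab t
    rw [hk t, show expComb u l t = expComb u (l - β) t * expComb u β t by
      rw [← expComb_add, sub_add_cancel]] at h1
    refine mul_right_cancel₀ (expComb_ne_zero (u := u) β t) ?_
    simp only [Pi.smul_apply, Pi.mul_apply, smul_eq_mul]
    linear_combination h1

end Borel

/-! ### A generic starting point. -/

/-- Only finitely many nonzero Laurent polynomials are to be avoided. A common shift of exponents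
makes them polynomials, and their product with all the coordinates is not identically zero. -/
theorem exists_forall_partial_sum_ne_zero {n : ℕ} (p : Fin n → LaurentPoly n) :
    ∃ c : Fin n → ℂ, (∀ j, c j ≠ 0) ∧ ∀ i, ∀ S ⊆ (p i).coeff.support, S.Nonempty →
      ∑ α ∈ S, (p i).coeff α * monomialAt α c ≠ 0 := by
  classical
  let T : Finset (Fin n → ℤ) := Finset.univ.biUnion fun i => (p i).coeff.support
  let N : ℕ := ∑ α ∈ T, ∑ j, (α j).natAbs
  have hN : ∀ α ∈ T, ∀ j, 0 ≤ α j + N := fun α hα j => by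
    have h1 : (α j).natAbs ≤ ∑ j, (α j).natAbs :=
      Finset.single_le_sum (f := fun j => (α j).natAbs) (fun _ _ => Nat.zero_le _)
        (Finset.mem_univ j)
    have h2 : ∑ j, (α j).natAbs ≤ N :=
      Finset.single_le_sum (f := fun α : Fin n → ℤ => ∑ j, (α j).natAbs)
        (fun _ _ => Nat.zero_le _) hα
    omega
  let sh : (Fin n → ℤ) → (Fin n →₀ ℕ) := fun α =>
    Finsupp.equivFunOnFinite.symm fun j => (α j + N).toNat
  have hsh : ∀ α ∈ T, ∀ β ∈ T, sh α = sh β → α = β := fun α hα β hβ h => by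
    ext j
    have := DFunLike.congr_fun h j
    simp only [sh, Finsupp.equivFunOnFinite_symm_apply_apply] at this
    have := hN α hα j
    have := hN β hβ j
    omega
  let q : Fin n → Finset (Fin n → ℤ) → MvPolynomial (Fin n) ℂ := fun i S =>
    ∑ α ∈ S, MvPolynomial.monomial (sh α) ((p i).coeff α)
  have hT : ∀ i, (p i).coeff.support ⊆ T := fun i =>
    Finset.subset_biUnion_of_mem (fun i => (p i).coeff.support) (Finset.mem_univ i)
  have hq0 : ∀ i, ∀ S ⊆ (p i).coeff.support, S.Nonempty → q i S ≠ 0 := by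
    rintro i S hS ⟨β, hβ⟩ h
    have h1 := congrArg (MvPolynomial.coeff (sh β)) h
    simp only [q, MvPolynomial.coeff_sum, MvPolynomial.coeff_monomial, MvPolynomial.coeff_zero] at h1
    rw [Finset.sum_eq_single β] at h1
    · simp only [if_true] at h1
      exact (Finsupp.mem_support_iff.1 (hS hβ)) h1
    · intro α hα hne
      rw [if_neg fun he => hne (hsh α (hT i (hS hα)) β (hT i (hS hβ)) he)]
    · exact fun h => absurd hβ h
  let Q : MvPolynomial (Fin n) ℂ := (∏ j, MvPolynomial.X j) *
    ∏ i, ∏ S ∈ (p i).coeff.support.powerset.filter (·.Nonempty), q i S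
  have hQ : Q ≠ 0 := by
    refine mul_ne_zero (Finset.prod_ne_zero_iff.2 fun j _ => MvPolynomial.X_ne_zero j)
      (Finset.prod_ne_zero_iff.2 fun i _ => Finset.prod_ne_zero_iff.2 fun S hS => ?_)
    rw [Finset.mem_filter, Finset.mem_powerset] at hS
    exact hq0 i S hS.1 hS.2
  obtain ⟨c, hc⟩ : ∃ c, MvPolynomial.eval c Q ≠ 0 := by
    by_contra! h
    exact hQ (MvPolynomial.funext fun c => by simp [h c])
  simp only [Q, map_mul, map_prod, MvPolynomial.eval_X] at hc
  have hc0 : ∀ j, c j ≠ 0 := fun j =>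
    Finset.prod_ne_zero_iff.1 (left_ne_zero_of_mul hc) j (Finset.mem_univ j)
  refine ⟨c, hc0, fun i S hS hSne h => ?_⟩
  have h1 := Finset.prod_ne_zero_iff.1 (Finset.prod_ne_zero_iff.1 (right_ne_zero_of_mul hc) i
    (Finset.mem_univ i)) S (Finset.mem_filter.2 ⟨Finset.mem_powerset.2 hS, hSne⟩)
  refine h1 ?_
  have : MvPolynomial.eval c (q i S)
      = (∏ j, c j ^ N) * ∑ α ∈ S, (p i).coeff α * monomialAt α c := by
    simp only [q, map_sum, MvPolynomial.eval_monomial, Finset.mul_sum]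
    refine Finset.sum_congr rfl fun α hα => ?_
    rw [Finsupp.prod_fintype _ _ (by simp), monomialAt, mul_left_comm, ← Finset.prod_mul_distrib]
    congr 1
    refine Finset.prod_congr rfl fun j _ => ?_
    simp only [sh, Finsupp.equivFunOnFinite_symm_apply_apply]
    rw [← zpow_natCast, Int.toNat_of_nonneg (hN α (hT i (hS hα)) j), zpow_add₀ (hc0 j),
      zpow_natCast, mul_comm]
  rw [this, h, mul_zero]


/-! ### Curves in the torus and their monomials. -/

theorem eq_of_hasDerivAt_mul {v w g : ℂ → ℂ} (hv : ∀ t, HasDerivAt v (v t * g t) t)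
    (hw : ∀ t, HasDerivAt w (w t * g t) t) (hw0 : ∀ t, w t ≠ 0) (h0 : v 0 = w 0) : v = w := by
  have hq : ∀ t, HasDerivAt (fun t => v t / w t) 0 t := fun t => by
    refine ((hv t).div (hw t) (hw0 t)).congr_deriv ?_
    rw [div_eq_zero_iff]
    left; ring
  funext t
  have h := is_const_of_deriv_eq_zero (fun t => (hq t).differentiableAt)
    (fun t => (hq t).deriv) t 0
  simp only [h0, div_self (hw0 0)] at h
  exact (div_eq_one_iff_eq (hw0 t)).1 h

theorem monomialAt_eq_expComb {n : ℕ} {u : Fin n → ℂ → ℂ} {z : Fin n → ℂ} {t : ℂ}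
    (h : ∀ j, z j = Complex.exp (u j t)) (α : Fin n → ℤ) :
    monomialAt α z = expComb u α t := by
  simp [monomialAt, expComb, Complex.exp_sum, h, Complex.exp_int_mul]

/-- Curves in the torus lift to the universal cover. -/
theorem exists_log_lift {n : ℕ} {z : ℂ → Fin n → ℂ} {g : Fin n → ℂ → ℂ}
    (hg : ∀ j, Differentiable ℂ (g j)) (hz0 : ∀ j, z 0 j ≠ 0)
    (hz : ∀ j t, HasDerivAt (fun t => z t j) (z t j * g j t) t) :
    ∃ u : Fin n → ℂ → ℂ, (∀ j t, HasDerivAt (u j) (g j t) t) ∧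
      ∀ j t, z t j = Complex.exp (u j t) := by
  have h : ∀ j, ∃ v : ℂ → ℂ, v 0 = Complex.log (z 0 j) ∧ ∀ t, HasDerivAt v (g j t) t := fun j => by
    obtain ⟨v, hv0, hv⟩ := (hg j).isExactOn_univ.with_val_at 0 (Complex.log (z 0 j))
    exact ⟨v, hv0, fun t => hv t trivial⟩
  choose u hu0 hu using h
  refine ⟨u, hu, fun j t => congrFun (eq_of_hasDerivAt_mul (hz j) (fun t => (hu j t).cexp)
    (fun t => Complex.exp_ne_zero _) ?_) t⟩
  rw [hu0, Complex.exp_log (hz0 j)]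

theorem zpow_sum₀ {G ι : Type*} [CommGroupWithZero G] {x : G} (hx : x ≠ 0) (s : Finset ι)
    (f : ι → ℤ) : x ^ (∑ i ∈ s, f i) = ∏ i ∈ s, x ^ f i := by
  classical
  induction s using Finset.induction_on with
  | empty => simp
  | insert i s hi ih => rw [Finset.sum_insert hi, Finset.prod_insert hi, zpow_add₀ hx, ih]

theorem differentiable_monomialAt {n : ℕ} {z : ℂ → Fin n → ℂ} (hz : Differentiable ℂ z)
    (h0 : ∀ t i, z t i ≠ 0) (α : Fin n → ℤ) : Differentiable ℂ fun t => monomialAt α (z t) := by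
  have hz' := differentiable_pi.1 hz
  exact Differentiable.fun_finsetProd fun j _ t => ((hz' j) t).zpow (Or.inl (h0 t j))

theorem LaurentPoly.differentiable_evalAt {n : ℕ} {z : ℂ → Fin n → ℂ} (hz : Differentiable ℂ z)
    (h0 : ∀ t i, z t i ≠ 0) (p : LaurentPoly n) : Differentiable ℂ fun t => p.evalAt (z t) :=
  Differentiable.fun_sum fun α _ => (differentiable_monomialAt hz h0 α).const_mul _

/-- On the logarithmic lift a monomial is the exponential of a linear form, so this is the chain
rule. -/
theorem hasDerivAt_monomialAt {n : ℕ} {z : ℂ → Fin n → ℂ} {g : Fin n → ℂ → ℂ}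
    (hg : ∀ j, Differentiable ℂ (g j)) (hz0 : ∀ j, z 0 j ≠ 0)
    (hz : ∀ j t, HasDerivAt (fun t => z t j) (z t j * g j t) t) (α : Fin n → ℤ) (t : ℂ) :
    HasDerivAt (fun t => monomialAt α (z t))
      (monomialAt α (z t) * ∑ j, (α j : ℂ) * g j t) t := by
  obtain ⟨u, hu, huz⟩ := exists_log_lift hg hz0 hz
  have h := hasDerivAt_expComb (fun j t => (hu j t).differentiableAt) α t
  simp only [fun j => (hu j t).deriv] at h
  rw [funext fun t => monomialAt_eq_expComb (fun j => huz j t) α]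
  exact h.congr_deriv (by rw [monomialAt_eq_expComb (fun j => huz j t) α])

theorem monomialAt_ne_zero {n : ℕ} {z : Fin n → ℂ} (hz : ∀ j, z j ≠ 0) (α : Fin n → ℤ) :
    monomialAt α z ≠ 0 :=
  Finset.prod_ne_zero_iff.2 fun j _ => zpow_ne_zero _ (hz j)

/-! ### Substitution of monomials. -/

namespace LaurentPoly

theorem evalAt_add {n : ℕ} (p q : LaurentPoly n) (z : Fin n → ℂ) :
    (p + q).evalAt z = p.evalAt z + q.evalAt z :=
  Finsupp.sum_add_index' (h := fun α c => c * monomialAt α z) (by simp) (by simp [add_mul])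

theorem evalAt_single {n : ℕ} (α : Fin n → ℤ) (c : ℂ) (z : Fin n → ℂ) :
    evalAt (AddMonoidAlgebra.single α c) z = c * monomialAt α z :=
  Finsupp.sum_single_index (h := fun α c => c * monomialAt α z) (by simp)

theorem evalAt_sum {n : ℕ} {ι : Type*} (s : Finset ι) (p : ι → LaurentPoly n) (z : Fin n → ℂ) :
    evalAt (∑ i ∈ s, p i) z = ∑ i ∈ s, (p i).evalAt z :=
  map_sum ({ toFun := fun p => p.evalAt z, map_zero' := by simp [evalAt],
             map_add' := fun p q => evalAt_add p q z } : LaurentPoly n →+ ℂ) p s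

theorem substMonomials_add {m n : ℕ} (a : Fin m → Fin n → ℤ) (p q : LaurentPoly m) :
    (p + q).substMonomials a = p.substMonomials a + q.substMonomials a := by
  let F : (Fin m → ℤ) → ℂ → LaurentPoly n :=
    fun β c => AddMonoidAlgebra.single (∑ i, β i • a i) c
  change (p.coeff + q.coeff).sum F = p.coeff.sum F + q.coeff.sum F
  exact Finsupp.sum_add_index' (fun _ => AddMonoidAlgebra.single_zero _)
    (fun _ _ _ => AddMonoidAlgebra.single_add _ _ _)

theorem substMonomials_single {m n : ℕ} (a : Fin m → Fin n → ℤ) (β : Fin m → ℤ) (c : ℂ) :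
    substMonomials a (AddMonoidAlgebra.single β c)
      = AddMonoidAlgebra.single (∑ i, β i • a i) c := by
  let F : (Fin m → ℤ) → ℂ → LaurentPoly n :=
    fun β c => AddMonoidAlgebra.single (∑ i, β i • a i) c
  change (Finsupp.single β c).sum F = F β c
  exact Finsupp.sum_single_index (AddMonoidAlgebra.single_zero _)

theorem substMonomials_sum {m n : ℕ} {ι : Type*} (a : Fin m → Fin n → ℤ) (s : Finset ι)
    (p : ι → LaurentPoly m) :
    substMonomials a (∑ i ∈ s, p i) = ∑ i ∈ s, (p i).substMonomials a :=
  map_sum ({ toFun := fun p => p.substMonomials a, map_zero' := by simp [substMonomials],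
             map_add' := fun p q => substMonomials_add a p q } : LaurentPoly m →+ LaurentPoly n) p s

theorem evalAt_substMonomials {m n : ℕ} (a : Fin m → Fin n → ℤ) (f : LaurentPoly m)
    {z : Fin n → ℂ} (hz : ∀ j, z j ≠ 0) :
    (f.substMonomials a).evalAt z = f.evalAt fun i => monomialAt (a i) z := by
  rw [substMonomials, evalAt_sum]
  refine Finset.sum_congr rfl fun β _ => ?_
  rw [evalAt_single]
  congr 1
  simp only [monomialAt, Finset.sum_apply, Pi.smul_apply, smul_eq_mul, ← Finset.prod_zpow,
    ← zpow_mul]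
  rw [Finset.prod_comm]
  refine Finset.prod_congr rfl fun j _ => ?_
  rw [zpow_sum₀ (hz j)]
  exact Finset.prod_congr rfl fun i _ => by rw [mul_comm]

theorem exists_eq_substMonomials {m n : ℕ} (a : Fin m → Fin n → ℤ) (p : LaurentPoly n)
    (h : ∀ α ∈ p.coeff.support, ∃ β : Fin m → ℤ, ∑ i, β i • a i = α) :
    ∃ f : LaurentPoly m, p = f.substMonomials a := by
  have h' : ∀ α, ∃ β : Fin m → ℤ, α ∈ p.coeff.support → ∑ i, β i • a i = α := fun α => by
    by_cases hα : α ∈ p.coeff.support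
    · obtain ⟨β, hβ⟩ := h α hα
      exact ⟨β, fun _ => hβ⟩
    · exact ⟨0, fun h => absurd h hα⟩
  choose β hβ using h'
  refine ⟨∑ α ∈ p.coeff.support, AddMonoidAlgebra.single (β α) (p.coeff α), ?_⟩
  rw [substMonomials_sum]
  conv_lhs => rw [← AddMonoidAlgebra.sum_coeff_single p]
  refine Finset.sum_congr rfl fun α hα => ?_
  rw [substMonomials_single, hβ α hα]

end LaurentPoly

/-! ### Reduction to the monomials of a basis. -/

/-- Integrally independent integer vectors have a complex right inverse. -/
theorem exists_right_inverse_of_linearIndependent {m n : ℕ} {a : Fin m → Fin n → ℤ}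
    (ha : LinearIndependent ℤ a) :
    ∃ B : Fin n → Fin m → ℂ, ∀ i k, ∑ j, (a i j : ℂ) * B j k = if i = k then 1 else 0 := by
  let φ : (Fin n → ℤ) →ₗ[ℤ] (Fin n → ℚ) := (Int.castAddHom ℚ).toIntLinearMap.compLeft (Fin n)
  have hφ : LinearMap.ker φ = ⊥ := by
    rw [LinearMap.ker_eq_bot]
    intro x y h
    ext j
    have := congrFun h j
    simpa [φ] using this
  -- Over the field ℚ an injective map has a left inverse; its matrix entries are then cast to ℂ.
  have hQ : LinearIndependent ℚ (φ ∘ a) :=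
    (LinearIndependent.iff_fractionRing ℤ ℚ).1 ((LinearMap.linearIndependent_iff φ hφ).2 ha)
  obtain ⟨g, hg⟩ := LinearMap.exists_leftInverse_of_injective
    (Fintype.linearCombination ℚ (φ ∘ a))
    (LinearMap.ker_eq_bot.2 (linearIndependent_iff_injective_fintypeLinearCombination.1 hQ))
  refine ⟨fun j k => (g (Pi.single j 1) k : ℚ), fun i k => ?_⟩
  have h1 : g (φ (a i)) = Pi.single i 1 := by
    have := LinearMap.congr_fun hg (Pi.single i 1)
    simpa [Fintype.linearCombination_apply_single] using this
  have h2 : φ (a i) = ∑ j, (a i j : ℚ) • (Pi.single j 1 : Fin n → ℚ) := by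
    rw [pi_eq_sum_univ' (φ (a i))]
    refine Finset.sum_congr rfl fun j _ => ?_
    ext k
    simp [φ, Pi.single_apply, eq_comm]
  rw [h2, map_sum] at h1
  have h3 := congrFun h1 k
  simp only [map_smul, Finset.sum_apply, Pi.smul_apply, smul_eq_mul, Pi.single_apply] at h3
  have h4 := congrArg (fun q : ℚ => (q : ℂ)) h3
  simp only [Rat.cast_sum, Rat.cast_mul, Rat.cast_intCast] at h4
  rw [h4]
  by_cases hik : i = k
  · simp [hik]
  · simp [hik, Ne.symm hik]

/-- Monomials with independent exponents map the torus onto the torus. -/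
theorem exists_forall_monomialAt_eq {m n : ℕ} {a : Fin m → Fin n → ℤ}
    (ha : LinearIndependent ℤ a) {w : Fin m → ℂ} (hw : ∀ i, w i ≠ 0) :
    ∃ c : Fin n → ℂ, (∀ j, c j ≠ 0) ∧ ∀ i, monomialAt (a i) c = w i := by
  obtain ⟨B, hB⟩ := exists_right_inverse_of_linearIndependent ha
  refine ⟨fun j => Complex.exp (∑ k, B j k * Complex.log (w k)), fun j => Complex.exp_ne_zero _,
    fun i => ?_⟩
  rw [monomialAt_eq_expComb (u := fun j _ => ∑ k, B j k * Complex.log (w k)) (t := 0)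
    (fun j => rfl), expComb]
  have : ∑ j, (a i j : ℂ) * ∑ k, B j k * Complex.log (w k) = Complex.log (w i) := by
    simp only [Finset.mul_sum, ← mul_assoc]
    rw [Finset.sum_comm]
    simp [← Finset.sum_mul, hB]
  rw [this, Complex.exp_log (hw i)]

theorem isCompleteOnTorus_iff_of_eq_substMonomials {m n : ℕ} {a : Fin m → Fin n → ℤ}
    (ha : LinearIndependent ℤ a) {p : Fin n → LaurentPoly n} {f : Fin n → LaurentPoly m}
    (hf : ∀ j, p j = (f j).substMonomials a) :
    IsCompleteOnTorus (fun z i => z i * (p i).evalAt z) ↔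
      IsCompleteOnTorus (fun w i => w i * ∑ j, (a i j : ℂ) * (f j).evalAt w) := by
  constructor
  · intro H w₀ hw₀
    -- Surjectivity supplies an orbit upstairs over every starting point downstairs.
    obtain ⟨c, hc0, hc⟩ := exists_forall_monomialAt_eq ha hw₀
    obtain ⟨z, hz0, hz, hd⟩ := H c hc0
    have hzd : Differentiable ℂ z := fun t => (hd t).differentiableAt
    refine ⟨fun t i => monomialAt (a i) (z t), ?_, fun t i => monomialAt_ne_zero (hz t) _,
      fun t => hasDerivAt_pi.2 fun i => ?_⟩
    · funext i
      simp only [hz0, hc]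
    · refine (hasDerivAt_monomialAt (fun j => (p j).differentiable_evalAt hzd hz) (hz 0)
        (fun j t => hasDerivAt_pi.1 (hd t) j) (a i) t).congr_deriv ?_
      simp only [hf, LaurentPoly.evalAt_substMonomials a _ (hz t)]
  · intro H c hc0
    obtain ⟨w, hw0, hw, hd⟩ := H (fun i => monomialAt (a i) c) fun i => monomialAt_ne_zero hc0 _
    have hwd : Differentiable ℂ w := fun t => (hd t).differentiableAt
    have hg : ∀ j, Differentiable ℂ fun t => (f j).evalAt (w t) := fun j =>
      (f j).differentiable_evalAt hwd hw
    have h : ∀ j, ∃ v : ℂ → ℂ, v 0 = Complex.log (c j) ∧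
        ∀ t, HasDerivAt v ((f j).evalAt (w t)) t := fun j => by
      obtain ⟨v, hv0, hv⟩ := (hg j).isExactOn_univ.with_val_at 0 (Complex.log (c j))
      exact ⟨v, hv0, fun t => hv t trivial⟩
    choose u hu0 hu using h
    set z : ℂ → Fin n → ℂ := fun t j => Complex.exp (u j t) with hzdef
    have hz : ∀ t j, z t j ≠ 0 := fun t j => Complex.exp_ne_zero _
    have hz0 : z 0 = c := by
      funext j
      simp [hzdef, hu0, Complex.exp_log (hc0 j)]
    have hzd : ∀ j t, HasDerivAt (fun t => z t j) (z t j * (f j).evalAt (w t)) t := fun j t =>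
      (hu j t).cexp
    -- Both sides solve the same scalar linear equations with the same initial value.
    have hzw : ∀ t, (fun i => monomialAt (a i) (z t)) = w t := fun t => by
      funext i
      refine congrFun (eq_of_hasDerivAt_mul (v := fun t => monomialAt (a i) (z t))
        (w := fun t => w t i) (hasDerivAt_monomialAt hg (hz 0) hzd (a i))
        (fun t => hasDerivAt_pi.1 (hd t) i) (fun t => hw t i) ?_) t
      simp only [hz0, hw0]
    refine ⟨z, hz0, hz, fun t => hasDerivAt_pi.2 fun j => (hzd j t).congr_deriv ?_⟩
    simp only [hf, LaurentPoly.evalAt_substMonomials a _ (hz t), hzw]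

/-! ### The full-rank case. -/

/-- Along an orbit starting at a point where no partial sum of some `p i` vanishes, all exponents
occurring in `p i` are controlled. -/
theorem support_subset_controlledExponents {n : ℕ} {p : LaurentPoly n} {u : Fin n → ℂ → ℂ}
    (hu : ∀ j, Differentiable ℂ (u j)) {G : ℂ → ℂ} (hG : G ∈ controlledGrowth u)
    (h : ∀ t, ∑ α ∈ p.coeff.support, p.coeff α * expComb u α t = G t)
    (hp : ∀ S ⊆ p.coeff.support, S.Nonempty → ∑ α ∈ S, p.coeff α * expComb u α 0 ≠ 0)
    {β : Fin n → ℤ} (hβ : β ∈ p.coeff.support) : β ∈ controlledExponents u := by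
  classical
  by_contra hβD
  set s := insert 0 p.coeff.support with hs
  -- `G` is moved to the left as part of the coefficient at exponent 0, which need not belong to the
  -- support.
  let c : (Fin n → ℤ) → ℂ → ℂ := fun α =>
    algebraMap ℂ (ℂ → ℂ) (p.coeff α) - if α = 0 then G else 0
  have hc : ∀ α, c α ∈ controlledGrowth u := fun α => by
    refine sub_mem (Subalgebra.algebraMap_mem _ _) ?_
    split_ifs
    exacts [hG, zero_mem _]
  have hsum : ∀ t, ∑ α ∈ s, c α t * expComb u α t = 0 := fun t => by
    have h1 : ∑ α ∈ s, p.coeff α * expComb u α t = G t := by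
      rw [← h t]
      refine (Finset.sum_subset (Finset.subset_insert _ _) fun α _ hα => ?_).symm
      rw [Finsupp.notMem_support_iff.1 hα, zero_mul]
    have h2 : ∑ α ∈ s, (if α = 0 then G else 0) t * expComb u α t = G t := by
      rw [Finset.sum_eq_single 0]
      · simp [expComb_zero]
      · intro α _ hα
        simp [hα]
      · exact fun h => absurd (Finset.mem_insert_self _ _) h
    simp only [c, Pi.sub_apply, sub_mul, Finset.sum_sub_distrib, h2]
    rw [← h1, sub_eq_zero]
    rfl
  have hcoset := sum_eq_zero_of_add_eq_zero hu (β := β)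
    (A := s.filter fun α => α - β ∈ controlledExponents u)
    (B := s.filter fun α => ¬ (α - β ∈ controlledExponents u))
    (fun α hα => (Finset.mem_filter.1 hα).2) (fun α hα => (Finset.mem_filter.1 hα).2) hc
    (fun t => by rw [Finset.sum_filter_add_sum_filter_not, hsum]) 0
  -- As β is not controlled, its coset misses 0, so `G` does not enter the coset sum, a genuine
  -- partial sum of `p`.
  have h0 : ∀ α, α - β ∈ controlledExponents u → α ≠ 0 := by
    rintro α hα rfl
    exact hβD (by simpa using hα)
  refine hp (s.filter fun α => α - β ∈ controlledExponents u) ?_ ⟨β, ?_⟩ ?_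
  · intro α hα
    rw [Finset.mem_filter] at hα
    exact Finset.mem_of_mem_insert_of_ne hα.1 (h0 α hα.2)
  · exact Finset.mem_filter.2 ⟨Finset.mem_insert_of_mem hβ, by simp [zero_mem]⟩
  · refine (Finset.sum_congr rfl fun α hα => ?_).trans hcoset
    simp [c, h0 α (Finset.mem_filter.1 hα).2]

/-- A field whose exponents generate a lattice of full rank is not complete. -/
theorem not_isCompleteOnTorus_of_finrank_eq {n : ℕ} (hn : 1 ≤ n) {p : Fin n → LaurentPoly n}
    (hp : Module.finrank ℤ (monomialLattice p) = n) :
    ¬ IsCompleteOnTorus (fun z i => z i * (p i).evalAt z) := by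
  intro H
  obtain ⟨c, hc0, hc⟩ := exists_forall_partial_sum_ne_zero p
  obtain ⟨z, hz0, hz, hd⟩ := H c hc0
  have hzd : Differentiable ℂ z := fun t => (hd t).differentiableAt
  obtain ⟨u, hu, huz⟩ := exists_log_lift (fun j => (p j).differentiable_evalAt hzd hz) (hz 0)
    (fun j t => hasDerivAt_pi.1 (hd t) j)
  have hud : ∀ j, Differentiable ℂ (u j) := fun j t => (hu j t).differentiableAt
  have hsub : ∀ i, ∀ β ∈ (p i).coeff.support, β ∈ controlledExponents u := fun i β hβ =>
    support_subset_controlledExponents hud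
      (deriv_mem_controlledGrowth ⟨hud i, .self hud i⟩)
      (fun t => by
        rw [(hu i t).deriv]
        exact Finset.sum_congr rfl fun α _ => by
          rw [monomialAt_eq_expComb (fun j => huz j t)])
      (fun S hS hne => by
        have := hc i S hS hne
        rw [← hz0] at this
        simpa only [monomialAt_eq_expComb fun j => huz j 0] using this) hβ
  have hle : monomialLattice p ≤ (controlledExponents u).toIntSubmodule :=
    Submodule.span_le.2 fun α ⟨i, hi⟩ => hsub i α (Finsupp.mem_support_iff.2 hi)
  have : Finite ((Fin n → ℤ) ⧸ monomialLattice p) :=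
    Submodule.finiteQuotientOfFreeOfRankEq _ (by simpa using hp)
  -- The index of the lattice serves as N, since it kills the finite quotient.
  have hconst := deriv_eq_zero_of_mul_exp_eq hud fun j => by
    have hmem : (Nat.card ((Fin n → ℤ) ⧸ monomialLattice p)) • (Pi.single j 1 : Fin n → ℤ)
        ∈ monomialLattice p := by
      rw [← Submodule.Quotient.mk_eq_zero, Submodule.Quotient.mk_smul]
      exact card_nsmul_eq_zero'
    obtain ⟨a, ha, b, hb, ha0, hab⟩ := hle hmem
    refine ⟨Nat.card ((Fin n → ℤ) ⧸ monomialLattice p), by exact_mod_cast Nat.card_pos.ne',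
      a, ha, b, hb, ha0, fun t => ?_⟩
    rw [← hab, expComb]
    congr 2
    rw [Finset.sum_eq_single j]
    · simp
    · intro k _ hk
      simp [hk]
    · simp
  -- The full sum is itself a partial sum; its value at the starting point is u_i'(0) = 0.
  have hzero : ∀ i, (p i).coeff.support = ∅ := fun i => by
    by_contra hne
    refine hc i _ subset_rfl (Finset.nonempty_iff_ne_empty.2 hne) ?_
    have := hconst i 0
    rwa [(hu i 0).deriv, hz0] at this
  have hbot : monomialLattice p = ⊥ := by
    rw [monomialLattice, Submodule.span_eq_bot]
    rintro α ⟨i, hi⟩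
    have := Finsupp.mem_support_iff.2 hi
    rw [hzero i] at this
    simp at this
  rw [hbot, finrank_bot] at hp
  omega

theorem theorem2 (n : ℕ) (hn : 1 ≤ n) (p : Fin n → LaurentPoly n)
    (m : ℕ) (hm : Module.finrank ℤ (monomialLattice p) = m) :
    (m = n → ¬ IsCompleteOnTorus (fun z i => z i * (p i).evalAt z)) ∧
    (m < n → ∀ b : Module.Basis (Fin m) ℤ (monomialLattice p),
      ∀ a : Fin m → Fin n → ℤ, (∀ i j, a i j = (b i : Fin n → ℤ) j) →
      (∃ f : Fin n → LaurentPoly m, ∀ j, p j = (f j).substMonomials a) ∧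
      ∀ f : Fin n → LaurentPoly m, (∀ j, p j = (f j).substMonomials a) →
        (IsCompleteOnTorus (fun z i => z i * (p i).evalAt z) ↔
          IsCompleteOnTorus (fun w i => w i * ∑ j, (a i j : ℂ) * (f j).evalAt w))) := by
  refine ⟨fun h => not_isCompleteOnTorus_of_finrank_eq hn (hm.trans h), fun _ b a hab => ?_⟩
  have hab' : a = (monomialLattice p).subtype ∘ b := by
    funext i j
    exact hab i j
  refine ⟨?_, fun f hf => isCompleteOnTorus_iff_of_eq_substMonomials ?_ hf⟩
  · have h : ∀ j, ∃ f : LaurentPoly m, p j = f.substMonomials a := fun j =>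
      LaurentPoly.exists_eq_substMonomials a (p j) fun α hα => by
        have hαp : α ∈ monomialLattice p :=
          Submodule.subset_span ⟨j, Finsupp.mem_support_iff.1 hα⟩
        refine ⟨b.repr ⟨α, hαp⟩, ?_⟩
        have := congrArg Subtype.val (b.sum_repr ⟨α, hαp⟩)
        rw [Submodule.coe_sum] at this
        rw [hab']
        exact this
    choose f hf using h
    exact ⟨f, hf⟩
  · rw [hab']
    exact b.linearIndependent.map' _ (Submodule.ker_subtype _)
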